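/- All groups are countable. Let $\mathrm{EG}$, the class of elementary amenable groups, be the smallest class of countable groups that contains all finite groups and all countable abelian groups and is closed under group extensions, countable increasing unions, subgroups, and quotients (and isomorphism). Define classes $\mathrm{EG}_\alpha$ of countable groups by transfinite recursion on the ordinal $\alpha$: - $G\in\mathrm{EG}_0$ if and only if $G$ is finite or countable abelian; - $G\in\mathrm{EG}_{\alpha+1}$ if and only if either there is a normal subgroup $N\trianglelefteq G$ with $N\in\mathrm{EG}_\alpha$ and $G/N\in\mathrm{EG}_0$, or $G=\bigcup_{i\in\mathbb N}H_i$ for an increasing sequence $H_0\le H_1\le\cdots$ of subgroups of $G$ with $H_i\in\mathrm{EG}_\alpha$ for all $i$; - $\mathrm{EG}_\lambda=\bigcup_{\beta<\lambda}\mathrm{EG}_\beta$ for $\lambda$ a limit ordinal. Every $G\in\mathrm{EG}$ lies in $\mathrm{EG}_\beta$ for some $\beta<\omega_1$, so its construction rank $\operatorname{rk}(G):=\min\{\alpha : G\in\mathrm{EG}_\alpha\}$ is defined and is a countable ordinal. For every ordinal $\alpha<\omega_1$ there is a finitely generated $G\in\mathrm{EG}$ such that $\alpha\le\operatorname{rk}(G)$.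 Consequently the function $\operatorname{rk}$ on finitely generated elementary amenable groups is unbounded below $\omega_1$, i.e. the supremum of its values is $\omega_1$. -/

import Mathlib

open scoped Ordinal

/-- The class of elementary amenable groups: the smallest (isomorphism-closed) class of countable
groups that contains the finite groups and the countable abelian groups and is closed under group
extensions, countable increasing unions, subgroups and quotients.  Closure under subgroups and
quotients is phrased with injective and surjective homomorphisms. -/
inductive ElementaryAmenable : (G : Type) → [Group G] → Prop
  | of_finite (G : Type) [Group G] [Finite G] : ElementaryAmenable G
  | of_comm (G : Type) [Group G] [Countable G] (h : ∀ a b : G, a * b = b * a) :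
      ElementaryAmenable G
  | extension (G : Type) [Group G] (N : Subgroup G) [N.Normal]
      (hN : ElementaryAmenable N) (hQ : ElementaryAmenable (G ⧸ N)) : ElementaryAmenable G
  | union (G : Type) [Group G] (H : ℕ → Subgroup G) (hmono : Monotone H)
      (hcover : ∀ g : G, ∃ i, g ∈ H i) (hH : ∀ i, ElementaryAmenable (H i)) :
      ElementaryAmenable G
  | subgroup (G H : Type) [Group G] [Group H] (f : H →* G) (hf : Function.Injective f)
      (hG : ElementaryAmenable G) : ElementaryAmenable H
  | quotient (G Q : Type) [Group G] [Group Q] (f : G →* Q) (hf : Function.Surjective f)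
      (hG : ElementaryAmenable G) : ElementaryAmenable Q

/-- The class `EG₀`: countable groups that are finite or abelian. -/
def IsEGZero (G : Type) [Group G] : Prop :=
  Countable G ∧ (Finite G ∨ ∀ a b : G, a * b = b * a)

/-- The passage from a class `C` (playing the role of `EG_α`) to the next one (`EG_{α+1}`):
extensions of a group in `EG₀` by a group in `C`, and unions of increasing sequences of subgroups
in `C`. -/
def EGStep (C : (G : Type) → [Group G] → Prop) (G : Type) [Group G] : Prop :=
  (∃ (N : Subgroup G) (_ : N.Normal), C N ∧ IsEGZero (G ⧸ N)) ∨
  (∃ H : ℕ → Subgroup G, Monotone H ∧ (∀ g : G, ∃ i, g ∈ H i) ∧ ∀ i, C (H i))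

/-- The hierarchy `EG_α`, by transfinite recursion on `α`: `EG₀` at zero, `EGStep` at successors,
and the union of the earlier classes at limits. -/
noncomputable def EGLevel (α : Ordinal.{0}) : (G : Type) → [Group G] → Prop :=
  Ordinal.limitRecOn (motive := fun _ => (G : Type) → [Group G] → Prop) α
    (fun G _ => IsEGZero G)
    (fun _ C G _ => EGStep C G)
    (fun l _ C G _ => ∃ (β : Ordinal.{0}) (h : β < l), C β h G)

/-- The construction rank of `G`: the least ordinal `α` with `G ∈ EG_α` (only meaningful if there
is such an ordinal). -/
noncomputable def constructionRank (G : Type) [Group G] : Ordinal.{0} :=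
  sInf {α : Ordinal.{0} | EGLevel α G}

/-! ### The hierarchy: recursion equations and closure properties -/

/-! Each `EGLevel α` passes to subgroups and quotients, so these operations cost no rank. Extensions
add ranks and unions take countable suprema, so every rank is countable.

For unboundedness, an elementary amenable `G` yields a two-generator `K = ⟨t, h⟩` in the
unrestricted wreath product of `G` by ℤ, with `h` so sparse that its translates commute modulo
finitely supported functions; hence `K` is elementary amenable. If `K/N` is finite or abelian, some
power of `t` is central modulo `N`, so `N` contains commutators of this power with `h`. Evaluating
their conjugates at one point gives all of `G`, so `G` is a quotient of a subgroup of `N`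
(`ElementaryAmenable.exists_fg`).

A finitely generated group cannot first appear at a union step. So if `K` first appears at level `β
+ 1`, some such `N`, and therefore `G`, has level `β`. Taking for `G` a restricted product of groups
built for smaller ordinals drives the transfinite induction `exists_fg_not_EGLevel`. -/

theorem EGLevel_zero_iff {G : Type} [Group G] : EGLevel 0 G ↔ IsEGZero G := by
  simp [EGLevel]

theorem EGLevel_add_one_iff {α : Ordinal.{0}} {G : Type} [Group G] :
    EGLevel (α + 1) G ↔ EGStep (EGLevel α) G := by
  simp [EGLevel]

theorem EGLevel_limit_iff {l : Ordinal.{0}} (hl : Order.IsSuccLimit l) {G : Type} [Group G] :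
    EGLevel l G ↔ ∃ β < l, EGLevel β G := by
  simp [EGLevel, hl]

theorem IsEGZero.of_injective {G H : Type} [Group G] [Group H] (h : IsEGZero G) (f : H →* G)
    (hf : Function.Injective f) : IsEGZero H := by
  obtain ⟨hc, h⟩ := h
  refine ⟨hf.countable,
    Or.imp (fun (_ : Finite G) => Finite.of_injective f hf) (fun h a b => hf ?_) h⟩
  rw [map_mul, map_mul, h]

theorem IsEGZero.of_surjective {G Q : Type} [Group G] [Group Q] (h : IsEGZero G) (f : G →* Q)
    (hf : Function.Surjective f) : IsEGZero Q := by
  obtain ⟨hc, h⟩ := h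
  refine ⟨hf.countable,
    Or.imp (fun (_ : Finite G) => Finite.of_surjective f hf) (fun h => ?_) h⟩
  intro a b
  obtain ⟨a, rfl⟩ := hf a
  obtain ⟨b, rfl⟩ := hf b
  rw [← map_mul, ← map_mul, h]

/-- The homomorphism induced by `f` on the quotients by `N` and its preimage is injective. -/
theorem quotient_map_comap_injective {G H : Type} [Group G] [Group H] (f : H →* G)
    (N : Subgroup G) [N.Normal] :
    Function.Injective (QuotientGroup.map (N.comap f) N f le_rfl) := by
  rw [injective_iff_map_eq_one]
  intro x
  induction x using QuotientGroup.induction_on with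
  | H x =>
    intro hx
    rw [QuotientGroup.map_mk, QuotientGroup.eq_one_iff] at hx
    rwa [QuotientGroup.eq_one_iff]

theorem subgroupComap_injective {G H : Type} [Group G] [Group H] (f : H →* G)
    (hf : Function.Injective f) (N : Subgroup G) : Function.Injective (f.subgroupComap N) :=
  fun _ _ h => Subtype.ext (hf (congrArg Subtype.val h))

theorem EGLevel.of_injective {α : Ordinal.{0}} {G H : Type} [Group G] [Group H]
    (h : EGLevel α G) (f : H →* G) (hf : Function.Injective f) : EGLevel α H := by
  induction α using Ordinal.limitRecOn generalizing G H with
  | zero => exact EGLevel_zero_iff.2 ((EGLevel_zero_iff.1 h).of_injective f hf)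
  | add_one α ih =>
    rw [EGLevel_add_one_iff] at h ⊢
    rcases h with ⟨N, hN, hNα, hQ⟩ | ⟨K, hmono, hcov, hK⟩
    · exact .inl ⟨N.comap f, inferInstance,
        ih hNα _ (subgroupComap_injective f hf N),
        hQ.of_injective _ (quotient_map_comap_injective f N)⟩
    · exact .inr ⟨fun i => (K i).comap f, fun i j hij => Subgroup.comap_mono (hmono hij),
        fun g => hcov (f g), fun i => ih (hK i) _ (subgroupComap_injective f hf (K i))⟩
  | limit l hl ih =>
    obtain ⟨β, hβ, h⟩ := (EGLevel_limit_iff hl).1 h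
    exact (EGLevel_limit_iff hl).2 ⟨β, hβ, ih β hβ h f hf⟩

theorem EGLevel.of_surjective {α : Ordinal.{0}} {G Q : Type} [Group G] [Group Q]
    (h : EGLevel α G) (f : G →* Q) (hf : Function.Surjective f) : EGLevel α Q := by
  induction α using Ordinal.limitRecOn generalizing G Q with
  | zero => exact EGLevel_zero_iff.2 ((EGLevel_zero_iff.1 h).of_surjective f hf)
  | add_one α ih =>
    rw [EGLevel_add_one_iff] at h ⊢
    rcases h with ⟨N, hN, hNα, hQ⟩ | ⟨K, hmono, hcov, hK⟩
    · have : (N.map f).Normal := hN.map f hf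
      refine .inl ⟨N.map f, this, ih hNα _ (f.subgroupMap_surjective N),
        hQ.of_surjective (QuotientGroup.map N (N.map f) f (Subgroup.le_comap_map f N)) ?_⟩
      intro x
      induction x using QuotientGroup.induction_on with
      | H x =>
        obtain ⟨g, rfl⟩ := hf x
        exact ⟨g, rfl⟩
    · refine .inr ⟨fun i => (K i).map f, fun i j hij => Subgroup.map_mono (hmono hij),
        fun q => ?_, fun i => ih (hK i) _ (f.subgroupMap_surjective (K i))⟩
      obtain ⟨g, rfl⟩ := hf q
      exact (hcov g).imp fun i hi => Subgroup.mem_map_of_mem f hi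
  | limit l hl ih =>
    obtain ⟨β, hβ, h⟩ := (EGLevel_limit_iff hl).1 h
    exact (EGLevel_limit_iff hl).2 ⟨β, hβ, ih β hβ h f hf⟩

theorem EGLevel.mono {α β : Ordinal.{0}} (hαβ : α ≤ β) {G : Type} [Group G]
    (h : EGLevel α G) : EGLevel β G := by
  induction β using Ordinal.limitRecOn with
  | zero => rwa [nonpos_iff_eq_zero.1 hαβ] at h
  | add_one β ih =>
    rcases hαβ.eq_or_lt with rfl | hlt
    · exact h
    -- A group is the union of the constant chain at itself.
    · exact EGLevel_add_one_iff.2 (.inr ⟨fun _ => ⊤, monotone_const, fun g => ⟨0, trivial⟩,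
        fun _ => (ih (Order.lt_add_one_iff.1 hlt)).of_injective _
          (Subgroup.subtype_injective ⊤)⟩)
  | limit l hl _ =>
    rcases hαβ.eq_or_lt with rfl | hlt
    · exact h
    · exact (EGLevel_limit_iff hl).2 ⟨α, hlt, h⟩

/-- The construction of `Q` is pulled back along `f` step by step. The kernel of each restriction
embeds in `f.ker`, and the `+ 1` pays for the initial step over an `EG₀` quotient. -/
theorem EGLevel.extension {α β : Ordinal.{0}} {G Q : Type} [Group G] [Group Q] (f : G →* Q)
    (hk : EGLevel α f.ker) (hQ : EGLevel β Q) : EGLevel (α + 1 + β) G := by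
  induction β using Ordinal.limitRecOn generalizing G Q with
  | zero =>
    rw [add_zero]
    exact EGLevel_add_one_iff.2 (.inl ⟨f.ker, inferInstance, hk,
      (EGLevel_zero_iff.1 hQ).of_injective _ (QuotientGroup.kerLift_injective f)⟩)
  | add_one β ih =>
    have key (M : Subgroup Q) (hM : EGLevel β M) : EGLevel (α + 1 + β) (M.comap f) := by
      refine ih (f.subgroupComap M) (hk.of_injective
        (((M.comap f).subtype.comp (f.subgroupComap M).ker.subtype).codRestrict f.ker ?_) ?_) hM
      · exact fun x => congrArg Subtype.val x.2
      · exact fun x y h => Subtype.ext (Subtype.ext (Subtype.ext_iff.1 h :))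
    rw [← add_assoc, EGLevel_add_one_iff]
    rcases EGLevel_add_one_iff.1 hQ with ⟨M, hM, hMβ, hQM⟩ | ⟨K, hmono, hcov, hK⟩
    · exact .inl ⟨M.comap f, inferInstance, key M hMβ,
        hQM.of_injective _ (quotient_map_comap_injective f M)⟩
    · exact .inr ⟨fun i => (K i).comap f, fun i j hij => Subgroup.comap_mono (hmono hij),
        fun g => hcov (f g), fun i => key _ (hK i)⟩
  | limit l hl ih =>
    obtain ⟨β, hβ, h⟩ := (EGLevel_limit_iff hl).1 hQ
    exact (ih β hβ f hk h).mono (add_le_add_right hβ.le _)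

theorem add_lt_omega_one {α β : Ordinal.{0}} (hα : α < ω₁) (hβ : β < ω₁) : α + β < ω₁ :=
  Ordinal.isPrincipal_add_omega 1 hα hβ

theorem one_lt_omega_one : (1 : Ordinal.{0}) < ω₁ :=
  Ordinal.one_lt_omega0.trans Ordinal.omega0_lt_omega_one

theorem ElementaryAmenable.exists_EGLevel {G : Type} [Group G] (h : ElementaryAmenable G) :
    ∃ β : Ordinal.{0}, β < ω₁ ∧ EGLevel β G := by
  have pos : (0 : Ordinal.{0}) < ω₁ := zero_lt_one.trans one_lt_omega_one
  induction h with
  | of_finite G => exact ⟨0, pos, EGLevel_zero_iff.2 ⟨Finite.to_countable, .inl ‹_›⟩⟩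
  | of_comm G h => exact ⟨0, pos, EGLevel_zero_iff.2 ⟨‹_›, .inr h⟩⟩
  | extension G N hN hQ ihN ihQ =>
    obtain ⟨α, hα, hNα⟩ := ihN
    obtain ⟨β, hβ, hQβ⟩ := ihQ
    refine ⟨α + 1 + β, add_lt_omega_one (add_lt_omega_one hα one_lt_omega_one) hβ,
      EGLevel.extension (QuotientGroup.mk' N) ?_ hQβ⟩
    rwa [QuotientGroup.ker_mk']
  | union G H hmono hcover hH ih =>
    choose β hβ hHβ using ih
    refine ⟨(⨆ i, β i) + 1, add_lt_omega_one (Ordinal.iSup_lt_omega_one hβ) one_lt_omega_one,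
      EGLevel_add_one_iff.2 (.inr ⟨H, hmono, hcover, fun i => (hHβ i).mono ?_⟩)⟩
    exact Ordinal.le_iSup β i
  | subgroup G H f hf hG ih => exact ih.imp fun β h => ⟨h.1, h.2.of_injective f hf⟩
  | quotient G Q f hf hG ih => exact ih.imp fun β h => ⟨h.1, h.2.of_surjective f hf⟩

theorem ElementaryAmenable.countable {G : Type} [Group G] (h : ElementaryAmenable G) :
    Countable G := by
  induction h with
  | of_finite G => exact Finite.to_countable
  | of_comm G h => assumption
  | extension G N hN hQ ihN ihQ =>
    exact (Subgroup.groupEquivQuotientProdSubgroup (s := N)).countable_iff.2 inferInstance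
  | union G H hmono hcover hH ih =>
    rw [← Set.countable_univ_iff]
    refine (Set.countable_iUnion fun i =>
      (Set.countable_coe_iff (s := (H i : Set G))).1 (ih i)).mono ?_
    exact fun g _ => Set.mem_iUnion.2 (hcover g)
  | subgroup G H f hf hG ih => exact hf.countable
  | quotient G Q f hf hG ih => exact hf.countable

/-! ### Closure properties of elementary amenable groups -/

theorem ElementaryAmenable.of_hom {G Q : Type} [Group G] [Group Q] (f : G →* Q)
    (hk : ElementaryAmenable f.ker) (hQ : ElementaryAmenable Q) : ElementaryAmenable G :=
  .extension G f.ker hk (.subgroup Q _ _ (QuotientGroup.kerLift_injective f) hQ)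

section FiniteSupport

variable {I : Type} {G : I → Type} [∀ i, Group (G i)]

/-- Evaluation at one coordinate has its kernel supported on the remaining ones. An abstract `D`
with an injection `φ` lets the induction pass to that kernel. -/
theorem ElementaryAmenable.of_support_subset (hG : ∀ i, ElementaryAmenable (G i)) (s : Finset I)
    (D : Type) [Group D] (φ : D →* ∀ i, G i) (hφ : Function.Injective φ)
    (hs : ∀ d, ∀ i ∉ s, φ d i = 1) : ElementaryAmenable D := by
  classical
  induction s using Finset.induction_on generalizing D with
  | empty =>
    have : Subsingleton D := ⟨fun a b => hφ (funext fun i => by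
      rw [hs a i (Finset.notMem_empty i), hs b i (Finset.notMem_empty i)])⟩
    exact .of_finite D
  | insert a s _ ih =>
    refine .of_hom ((Pi.evalMonoidHom G a).comp φ) (ih _ (φ.comp (Subgroup.subtype _))
      (hφ.comp Subtype.val_injective) fun d i hi => ?_) (hG a)
    by_cases h : i = a
    · subst h
      exact d.2
    · exact hs d i (by simp [h, hi])

theorem ElementaryAmenable.of_finite_support [Countable I]
    (hG : ∀ i, ElementaryAmenable (G i)) (D : Type) [Group D] (φ : D →* ∀ i, G i)
    (hφ : Function.Injective φ) (hfin : ∀ d, {i | φ d i ≠ 1}.Finite) : ElementaryAmenable D := by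
  obtain ⟨e, he⟩ := exists_injective_nat I
  -- `H n` consists of the elements supported on the finitely many indices numbered below `n`.
  let H (n : ℕ) : Subgroup D :=
    { carrier := {d | ∀ i, n ≤ e i → φ d i = 1}
      mul_mem' := fun {a b} ha hb i hi => by simp [ha i hi, hb i hi]
      one_mem' := fun i _ => by simp
      inv_mem' := fun {a} ha i hi => by simp [ha i hi] }
  refine .union D H (fun m n hmn d hd i hi => hd i (hmn.trans hi)) (fun d => ?_) fun n => ?_
  · obtain ⟨n, hn⟩ := ((hfin d).image e).bddAbove
    refine ⟨n + 1, fun i hi => ?_⟩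
    by_contra h
    have := hn (Set.mem_image_of_mem e h)
    omega
  · have hf : {i | e i < n}.Finite := (Set.finite_lt_nat n).preimage he.injOn
    refine .of_support_subset hG hf.toFinset (H n) (φ.comp (H n).subtype)
      (hφ.comp Subtype.val_injective) fun d i hi => d.2 i ?_
    simpa using hi

variable (G) in
/-- The subgroup of finitely supported elements of a product of groups. -/
def finiteSupport : Subgroup (∀ i, G i) where
  carrier := {f | {i | f i ≠ 1}.Finite}
  mul_mem' {a b} ha hb := (Set.Finite.union ha hb).subset fun i hi => by
    by_contra h
    simp only [Set.mem_union, Set.mem_ofPred_eq, not_or, not_not] at h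
    exact hi (by simp [h.1, h.2])
  one_mem' := by simp
  inv_mem' {a} ha := by simpa using ha

instance : (finiteSupport G).Normal where
  conj_mem f hf g := Set.Finite.subset hf fun i hi h => hi (by simp [h])

theorem ElementaryAmenable.finiteSupport [Countable I] (hG : ∀ i, ElementaryAmenable (G i)) :
    ElementaryAmenable (finiteSupport G) :=
  .of_finite_support hG _ (Subgroup.subtype _) (Subgroup.subtype_injective _) fun d => d.2

end FiniteSupport

/-! ### Sparse functions on the integers -/

/-- Distinct powers of two differ by at least half of either one, so a bound on the difference
bounds both powers. -/
theorem two_pow_le_two_mul_abs_sub {i j : ℕ} (h : (2 : ℤ) ^ i ≠ 2 ^ j) :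
    (2 : ℤ) ^ i ≤ 2 * |2 ^ i - 2 ^ j| := by
  have hi : (0 : ℤ) < 2 ^ i := by positivity
  rcases lt_trichotomy i j with hij | rfl | hij
  · have : (2 : ℤ) ^ (i + 1) ≤ 2 ^ j := pow_le_pow_right₀ (by norm_num) hij
    rw [pow_succ] at this
    rw [abs_sub_comm]
    linarith [le_abs_self ((2 : ℤ) ^ j - 2 ^ i)]
  · exact absurd rfl h
  · have : (2 : ℤ) ^ (j + 1) ≤ 2 ^ i := pow_le_pow_right₀ (by norm_num) hij
    rw [pow_succ] at this
    linarith [le_abs_self ((2 : ℤ) ^ i - 2 ^ j)]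

/-- A function on `ℤ` whose support meets each proper translate of itself in a finite set, and which
takes every value at a point whose translate by a prescribed nonzero amount is off the support. -/
theorem exists_sparse_function (G : Type) [Group G] [Countable G] :
    ∃ h : Multiplicative ℤ → G,
      (∀ k l, k ≠ l → {x | h (k⁻¹ * x) ≠ 1 ∧ h (l⁻¹ * x) ≠ 1}.Finite) ∧
      ∀ k, k ≠ 1 → ∀ c, ∃ x, h x = c ∧ h (k * x) = 1 := by
  obtain ⟨e, he⟩ := exists_surjective_nat G
  let p (i : ℕ) : Multiplicative ℤ := Multiplicative.ofAdd (2 ^ i)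
  have hp : Function.Injective p := fun i j hij =>
    Int.pow_right_injective (a := 2) (by norm_num) (Multiplicative.ofAdd.injective hij)
  -- The values sit at powers of two; the first component of `Nat.unpair` repeats each one
  -- infinitely often, hence arbitrarily far out.
  let h : Multiplicative ℤ → G := Function.extend p (fun i => e (Nat.unpair i).1) 1
  have hne {x} (hx : h x ≠ 1) : ∃ i, p i = x := by
    by_contra hc
    exact hx (Function.extend_apply' _ _ _ hc)
  refine ⟨h, fun k l hkl => ?_, fun k hk c => ?_⟩
  -- If `x - k` and `x - l` are powers of two, they differ by `l - k`, so `0 < x - k ≤ 2|l - k|`.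
  · refine ((Set.finite_Icc k.toAdd (k.toAdd + 2 * |l.toAdd - k.toAdd|)).preimage
      Multiplicative.toAdd.injective.injOn).subset ?_
    rintro x ⟨hx, hy⟩
    obtain ⟨i, hi⟩ := hne hx
    obtain ⟨j, hj⟩ := hne hy
    have hi : (2 : ℤ) ^ i = -k.toAdd + x.toAdd := congrArg Multiplicative.toAdd hi
    have hj : (2 : ℤ) ^ j = -l.toAdd + x.toAdd := congrArg Multiplicative.toAdd hj
    have hkl : k.toAdd ≠ l.toAdd := fun h => hkl (Multiplicative.toAdd.injective h)
    have hij : (2 : ℤ) ^ i ≠ 2 ^ j := by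
      rw [hi, hj]
      omega
    have := two_pow_le_two_mul_abs_sub hij
    have hpos : (0 : ℤ) < 2 ^ i := by positivity
    rw [show (2 : ℤ) ^ i - 2 ^ j = l.toAdd - k.toAdd by rw [hi, hj]; ring] at this
    simp only [Set.mem_preimage, Set.mem_Icc]
    constructor <;> linarith
  · obtain ⟨n, rfl⟩ := he c
    -- The second component only makes `m ≥ 2|k|`. Then `2 ^ m > 2|k|`, too large for `2 ^ m + k` to
    -- be another power of two.
    let m := Nat.pair n (2 * k.toAdd.natAbs)
    refine ⟨p m, ?_, ?_⟩
    · simp [h, hp.extend_apply, m]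
    · by_contra hc
      obtain ⟨j, hj⟩ := hne hc
      have hj : (2 : ℤ) ^ j = k.toAdd + 2 ^ m := congrArg Multiplicative.toAdd hj
      have hk : k.toAdd ≠ 0 := fun h => hk (Multiplicative.toAdd.injective h)
      have h1 := two_pow_le_two_mul_abs_sub (i := m) (j := j) (by rw [hj]; omega)
      rw [show (2 : ℤ) ^ m - 2 ^ j = -k.toAdd by rw [hj]; ring, abs_neg,
        Int.abs_eq_natAbs] at h1
      have h2 : 2 * k.toAdd.natAbs ≤ m := Nat.right_le_pair _ _
      have h3 : m < 2 ^ m := Nat.lt_two_pow_self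
      have h1 : 2 ^ m ≤ 2 * k.toAdd.natAbs := by exact_mod_cast h1
      omega

/-! ### Embedding into finitely generated groups -/

section Sparse

variable {G : Type} [Group G]

/-- The group of functions generated by all translates of `h`. -/
def translateClosure (h : Multiplicative ℤ → G) : Subgroup (Multiplicative ℤ → G) :=
  Subgroup.closure (Set.range fun k x => h (k⁻¹ * x))

theorem translate_mem_translateClosure (h : Multiplicative ℤ → G) {f : Multiplicative ℤ → G}
    (hf : f ∈ translateClosure h) (k : Multiplicative ℤ) :
    (fun x => f (k * x)) ∈ translateClosure h := by
  induction hf using Subgroup.closure_induction with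
  | mem f hf =>
    obtain ⟨l, rfl⟩ := hf
    refine Subgroup.subset_closure ⟨k⁻¹ * l, funext fun x => ?_⟩
    simp [mul_assoc]
  | one => exact one_mem _
  | mul f g _ _ hf hg => exact mul_mem hf hg
  | inv f _ hf => exact inv_mem hf

/-- Two distinct translates of `h` commute pointwise off a finite set, so the group is abelian
modulo its finitely supported elements. Countability comes from the countable generating set. -/
theorem ElementaryAmenable.translateClosure (hG : ElementaryAmenable G)
    {h : Multiplicative ℤ → G}
    (hh : ∀ k l, k ≠ l → {x | h (k⁻¹ * x) ≠ 1 ∧ h (l⁻¹ * x) ≠ 1}.Finite) :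
    ElementaryAmenable (translateClosure h) := by
  let F := _root_.finiteSupport fun _ : Multiplicative ℤ => G
  let π := QuotientGroup.mk' F
  have hcomm : IsMulCommutative ((_root_.translateClosure h).map π) := by
    rw [_root_.translateClosure, MonoidHom.map_closure]
    refine Subgroup.isMulCommutative_closure ?_
    rintro _ ⟨_, ⟨k, rfl⟩, rfl⟩ _ ⟨_, ⟨l, rfl⟩, rfl⟩
    rw [← map_mul, ← map_mul]
    refine QuotientGroup.eq.2 ?_
    by_cases hkl : k = l
    · subst hkl
      rw [inv_mul_cancel]
      exact one_mem _
    · refine (hh k l hkl).subset fun x hx => ?_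
      by_contra hc
      refine hx ?_
      rw [Set.mem_ofPred_eq, not_and_or, not_not, not_not] at hc
      rcases hc with hc | hc <;> simp [hc]
  have : Countable (_root_.translateClosure h) := by
    rw [_root_.translateClosure, ← FreeGroup.range_lift_eq_closure]
    exact (MonoidHom.rangeRestrict_surjective _).countable
  refine .of_hom (π.subgroupMap (_root_.translateClosure h)) ?_ ?_
  · refine .subgroup F _ (((_root_.translateClosure h).subtype.comp
      (Subgroup.subtype _)).codRestrict F fun x => ?_) ?_ (.finiteSupport fun _ => hG)
    · exact (QuotientGroup.eq_one_iff _).1 (congrArg Subtype.val x.2)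
    · exact fun x y h => Subtype.ext (Subtype.ext (Subtype.ext_iff.1 h :))
  · have : Countable ((_root_.translateClosure h).map π) :=
      (π.subgroupMap_surjective _).countable
    exact .of_comm _ fun a b => hcomm.is_comm.comm a b

/-- Elements of the unrestricted wreath product with base component in `translateClosure h`. -/
def translateWreath (h : Multiplicative ℤ → G) : Subgroup (G ≀ᵣ Multiplicative ℤ) where
  carrier := {x | x.left ∈ translateClosure h}
  mul_mem' {a _} ha hb := mul_mem (show a.left ∈ translateClosure h from ha)
    (translate_mem_translateClosure h hb a.right⁻¹)
  one_mem' := one_mem (translateClosure h)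
  inv_mem' {a} ha := translate_mem_translateClosure h (inv_mem (show a.left ∈ _ from ha)) a.right

theorem ElementaryAmenable.translateWreath (hG : ElementaryAmenable G)
    {h : Multiplicative ℤ → G}
    (hh : ∀ k l, k ≠ l → {x | h (k⁻¹ * x) ≠ 1 ∧ h (l⁻¹ * x) ≠ 1}.Finite) :
    ElementaryAmenable (translateWreath h) := by
  let ρ := (RegularWreathProduct.rightHom (D := G) (Q := Multiplicative ℤ)).comp
    (_root_.translateWreath h).subtype
  have hρ (x : ρ.ker) : x.1.1.right = 1 := x.2
  refine .of_hom ρ (.subgroup (_root_.translateClosure h) _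
    { toFun := fun x => ⟨x.1.1.left, x.1.2⟩
      map_one' := rfl
      map_mul' := fun x y => Subtype.ext ?_ } ?_ (hG.translateClosure hh))
    (.of_comm _ mul_comm)
  · funext z
    simp [hρ x]
  · intro x y hxy
    refine Subtype.ext (Subtype.ext (RegularWreathProduct.ext (Subtype.ext_iff.1 hxy :) ?_))
    rw [hρ x, hρ y]

/-- Some positive power of `t` is central in the quotient: the power by the order if it is finite,
`t` itself if it is abelian. -/
theorem exists_pow_commutator_mem {K : Type} [Group K] (N : Subgroup K) [N.Normal]
    (hN : IsEGZero (K ⧸ N)) (t : K) : ∃ k : ℕ, 0 < k ∧ ∀ x : K, t ^ k * x * (t ^ k)⁻¹ * x⁻¹ ∈ N := by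
  suffices ∃ k : ℕ, 0 < k ∧ ∀ x : K ⧸ N, (t : K ⧸ N) ^ k * x = x * (t : K ⧸ N) ^ k by
    obtain ⟨k, hk, h⟩ := this
    refine ⟨k, hk, fun x => (QuotientGroup.eq_one_iff _).1 ?_⟩
    have h := h x
    have hx : (t : K ⧸ N) ^ k * x * ((t : K ⧸ N) ^ k)⁻¹ * (x : K ⧸ N)⁻¹ = 1 := by
      rw [h, mul_inv_cancel_right, mul_inv_cancel]
    exact hx
  rcases hN.2 with hfin | hcomm
  · exact ⟨Nat.card (K ⧸ N), Nat.card_pos, fun x => by simp⟩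
  · exact ⟨1, one_pos, fun x => hcomm _ _⟩

/-- Every elementary amenable group is a quotient of a subgroup of each normal subgroup with finite
or abelian quotient in some finitely generated elementary amenable group. -/
theorem ElementaryAmenable.exists_fg (hG : ElementaryAmenable G) :
    ∃ (K : Type) (_ : Group K), Group.FG K ∧ ElementaryAmenable K ∧
      ∀ (N : Subgroup K) (_ : N.Normal), IsEGZero (K ⧸ N) →
        ∃ (L : Subgroup N) (f : L →* G), Function.Surjective f := by
  have := hG.countable
  obtain ⟨h, hsparse, hval⟩ := exists_sparse_function G
  let t₀ : G ≀ᵣ Multiplicative ℤ := RegularWreathProduct.inl (Multiplicative.ofAdd 1)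
  let h₀ : G ≀ᵣ Multiplicative ℤ := ⟨h, 1⟩
  let K := Subgroup.closure ({t₀, h₀} : Set (G ≀ᵣ Multiplicative ℤ))
  have hK : K ≤ _root_.translateWreath h := by
    rw [Subgroup.closure_le]
    rintro x (rfl | rfl)
    · exact one_mem (_root_.translateClosure h)
    · exact Subgroup.subset_closure ⟨1, funext fun x => by simp [h₀]⟩
  refine ⟨K, inferInstance, Group.closure_finite_fg _, .subgroup _ _ (Subgroup.inclusion hK)
    (Subgroup.inclusion_injective hK) (hG.translateWreath hsparse), fun N hN hQ => ?_⟩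
  let t : K := ⟨t₀, Subgroup.subset_closure (by simp)⟩
  let b : K := ⟨h₀, Subgroup.subset_closure (by simp)⟩
  have ht (n : ℤ) : (t ^ n).1 = RegularWreathProduct.inl (Multiplicative.ofAdd n) := by
    rw [Subgroup.coe_zpow, ← map_zpow, ← ofAdd_zsmul, smul_eq_mul, mul_one]
  let ρ := (RegularWreathProduct.rightHom (D := G) (Q := Multiplicative ℤ)).comp
    (K.subtype.comp N.subtype)
  have hρ (x : ρ.ker) : x.1.1.1.right = 1 := x.2
  -- `L` is the part of `N` in the base group, where evaluation at a point is multiplicative because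
  -- the ℤ-component is trivial.
  refine ⟨ρ.ker,
    { toFun := fun x => x.1.1.1.left 1
      map_one' := rfl
      map_mul' := fun x y => by simp [hρ x] }, fun c => ?_⟩
  obtain ⟨k, hk, hcomm⟩ := exists_pow_commutator_mem N hQ t
  obtain ⟨x, hx, hkx⟩ := hval (Multiplicative.ofAdd (k : ℤ)) (by simpa using hk.ne') c
  -- The commutator of `t ^ k` with `h` is `z ↦ h (z - k) * (h z)⁻¹`. Conjugating by `t ^ (-n)`
  -- moves its value at `n` to the identity of ℤ, and at `n = k + x` this value is `h x * (h (k +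
  -- x))⁻¹ = c`.
  let n : ℤ := k + x.toAdd
  have hmem := hN.conj_mem _ (hcomm b) (t ^ (-n))
  have hb : b.1 = h₀ := rfl
  rw [← zpow_natCast] at hmem
  refine ⟨⟨⟨_, hmem⟩, ?_⟩, ?_⟩
  · simp [ρ, MonoidHom.mem_ker, hb, h₀]
  · have hn : Multiplicative.ofAdd n = Multiplicative.ofAdd (k : ℤ) * x := rfl
    simp only [MonoidHom.coe_mk, OneHom.coe_mk, Subgroup.coe_mul, Subgroup.coe_inv, ht, hb,
      RegularWreathProduct.mul_left, RegularWreathProduct.mul_right,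
      RegularWreathProduct.inv_left, RegularWreathProduct.inv_right,
      RegularWreathProduct.left_inl, RegularWreathProduct.right_inl, Pi.mul_apply, Pi.inv_apply,
      Pi.one_apply, h₀]
    simp [hn, hx, hkx]

end Sparse

/-! ### Unboundedness of the rank -/

theorem ElementaryAmenable.prod {G H : Type} [Group G] [Group H] (hG : ElementaryAmenable G)
    (hH : ElementaryAmenable H) : ElementaryAmenable (G × H) := by
  refine .of_hom (MonoidHom.snd G H) (.subgroup G _ ((MonoidHom.fst G H).comp
    (Subgroup.subtype _)) (fun x y hxy => ?_) hG) hH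
  exact Subtype.ext (Prod.ext hxy ((show x.1.2 = 1 from x.2).trans (show y.1.2 = 1 from y.2).symm))

/-- A group all of whose normal subgroups with finite or abelian quotient are nontrivial is not in
`EG₀`. -/
theorem not_EGLevel_zero {K : Type} [Group K] (h : ∀ (N : Subgroup K) (_ : N.Normal),
    IsEGZero (K ⧸ N) → Nontrivial N) : ¬ EGLevel 0 K := by
  intro h0
  have := h ⊥ inferInstance ((EGLevel_zero_iff.1 h0).of_surjective (QuotientGroup.mk' ⊥)
    (QuotientGroup.mk'_surjective ⊥))
  exact not_subsingleton (⊥ : Subgroup K) inferInstance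

/-- A finitely generated group obtained by one step from a class `C` not containing it is an
extension of a group in `EG₀` by a group in `C`. -/
theorem EGStep.exists_normal_of_fg {C : (G : Type) → [Group G] → Prop}
    (hC : ∀ (G H : Type) [Group G] [Group H], G ≃* H → C G → C H)
    {K : Type} [Group K] [hK : Group.FG K] (h : EGStep C K) (hn : ¬ C K) :
    ∃ (N : Subgroup K) (_ : N.Normal), C N ∧ IsEGZero (K ⧸ N) := by
  rcases h with h | ⟨H, hmono, hcov, hH⟩
  · exact h
  -- A finite generating set already lies in one term of the chain, which is then all of `K`.
  · obtain ⟨S, hS⟩ := Group.fg_def.1 hK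
    choose i hi using hcov
    have htop : H (S.sup i) = ⊤ := by
      rw [eq_top_iff, ← hS, Subgroup.closure_le]
      exact fun s hs => hmono (Finset.le_sup hs) (hi s)
    have := hH (S.sup i)
    rw [htop] at this
    exact absurd (hC _ _ Subgroup.topEquiv this) hn

theorem exists_fg_not_EGLevel (α : Ordinal.{0}) (hα : α < ω₁) :
    ∃ (G : Type) (_ : Group G), Group.FG G ∧ ElementaryAmenable G ∧
      ∀ β < α, ¬ EGLevel β G := by
  induction α using WellFoundedLT.induction with
  | ind α ih =>
    -- A countable index set keeps the restricted product elementary amenable.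
    have hcount : Countable α.ToType := by
      rwa [← Cardinal.mk_le_aleph0_iff, Cardinal.mk_toType, ← Order.lt_succ_iff,
        Cardinal.succ_aleph0, ← Cardinal.lt_ord, Cardinal.ord_aleph]
    choose G hGrp _ hEA hG using fun i : α.ToType =>
      ih i.toOrd.1 i.toOrd.2 (lt_trans i.toOrd.2 hα)
    -- The factor ℤ makes the group nontrivial even if every `G i` is trivial, as level zero
    -- requires.
    have hD : ElementaryAmenable (finiteSupport G × Multiplicative ℤ) :=
      (ElementaryAmenable.finiteSupport hEA).prod (.of_comm _ mul_comm)
    obtain ⟨K, hKgrp, hfg, hKEA, hK⟩ := hD.exists_fg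
    refine ⟨K, hKgrp, hfg, hKEA, fun β hβ => ?_⟩
    induction β using Ordinal.limitRecOn with
    | zero =>
      refine not_EGLevel_zero fun N hN hQ => ?_
      obtain ⟨L, f, hf⟩ := hK N hN hQ
      have := hf.nontrivial
      exact L.subtype_injective.nontrivial
    | add_one β ihβ =>
      intro h
      obtain ⟨N, hN, hNβ, hQ⟩ := (EGLevel_add_one_iff.1 h).exists_normal_of_fg
        (fun G H _ _ e hG => hG.of_surjective e.toMonoidHom e.surjective)
        (ihβ ((lt_add_one β).trans hβ))
      obtain ⟨L, f, hf⟩ := hK N hN hQ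
      have hD : EGLevel β (finiteSupport G × Multiplicative ℤ) :=
        (hNβ.of_injective L.subtype L.subtype_injective).of_surjective f hf
      -- Since `β + 1 < α`, the factor indexed by `β + 1` is present. It was chosen outside `EG_β`,
      -- yet it embeds in a group of level `β`.
      let i : α.ToType := Ordinal.ToType.mk ⟨β + 1, hβ⟩
      have hi : i.toOrd.1 = β + 1 := by simp [i]
      refine hG i β (hi ▸ lt_add_one β) ?_
      classical
      refine hD.of_injective ((MonoidHom.inl _ _).comp
        ((MonoidHom.mulSingle G i).codRestrict (finiteSupport G) fun g => ?_)) fun x y hxy => ?_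
      · refine (Set.finite_singleton i).subset fun j hj => ?_
        by_contra hji
        exact hj (Pi.mulSingle_eq_of_ne hji g)
      · exact Pi.mulSingle_injective i (Subtype.ext_iff.1 (Prod.ext_iff.1 hxy).1 :)
    | limit l hl ihl =>
      intro h
      obtain ⟨β, hβl, h⟩ := (EGLevel_limit_iff hl).1 h
      exact ihl β hβl (hβl.trans hβ) h

theorem EGLevel_constructionRank {G : Type} [Group G] (h : ElementaryAmenable G) :
    EGLevel (constructionRank G) G := by
  obtain ⟨β, -, hβ⟩ := h.exists_EGLevel
  exact csInf_mem (s := {α : Ordinal.{0} | EGLevel α G}) ⟨β, hβ⟩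

theorem constructionRank_lt_omega_one {G : Type} [Group G] (h : ElementaryAmenable G) :
    constructionRank G < ω₁ := by
  obtain ⟨β, hβ, hG⟩ := h.exists_EGLevel
  exact (csInf_le' (s := {α : Ordinal.{0} | EGLevel α G}) hG).trans_lt hβ

theorem exists_fg_le_constructionRank (α : Ordinal.{0}) (hα : α < ω₁) :
    ∃ (G : Type) (_ : Group G), Group.FG G ∧ ElementaryAmenable G ∧ α ≤ constructionRank G := by
  obtain ⟨G, hG, hfg, hEA, h⟩ := exists_fg_not_EGLevel α hα
  exact ⟨G, hG, hfg, hEA, le_of_not_gt fun hlt => h _ hlt (EGLevel_constructionRank hEA)⟩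

theorem mainTheorem11 :
    -- the rank is defined on elementary amenable groups and takes values below `ω₁`
    (∀ (G : Type) [Group G], ElementaryAmenable G →
      ∃ β : Ordinal.{0}, β < ω₁ ∧ EGLevel β G) ∧
    -- every countable ordinal is at most the rank of a finitely generated such group
    (∀ α : Ordinal.{0}, α < ω₁ →
      ∃ (G : Type) (_ : Group G),
        Group.FG G ∧ ElementaryAmenable G ∧ α ≤ constructionRank G) ∧
    -- hence the rank is unbounded below `ω₁` on finitely generated elementary amenable groups
    IsLUB {β : Ordinal.{0} | ∃ (G : Type) (_ : Group G),
      Group.FG G ∧ ElementaryAmenable G ∧ constructionRank G = β} ω₁ := by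
  refine ⟨fun G _ h => h.exists_EGLevel, exists_fg_le_constructionRank, ?_, fun b hb => ?_⟩
  · rintro _ ⟨G, _, -, h, rfl⟩
    exact (constructionRank_lt_omega_one h).le
  · by_contra hlt
    -- A bound `b < ω₁` fails because `b + 1` is still countable and so is at most some rank.
    obtain ⟨G, hG, hfg, hEA, h⟩ := exists_fg_le_constructionRank (b + 1)
      (add_lt_omega_one (not_le.1 hlt) one_lt_omega_one)
    exact (lt_add_one b).not_ge (h.trans (hb ⟨G, hG, hfg, hEA, rfl⟩))
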